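/- Let $m\in\mathbb N$ and let $\mathbb R^m$ carry the Euclidean norm. Let $f:\mathbb R^m\to\mathbb R\cup\{+\infty\}$ be proper and lower semicontinuous, and let $g:\mathbb R^m\to\mathbb R$ be differentiable with $\|\nabla g(u)-\nabla g(v)\|\le L_g\|u-v\|$ for all $u,v\in\mathbb R^m$, where $L_g\ge 0$. Let $(\alpha_n)_{n\in\mathbb N},(\beta_n)_{n\in\mathbb N}$ be real sequences with $\alpha_n\to\alpha$ and $\beta_n\to\beta\in\mathbb R$, let $s>0$, let $x_{-1}=x_0\in\mathbb R^m$, and for all $n\in\mathbb N$ let $$y_n=x_n+\alpha_n(x_n-x_{n-1}),\qquad z_n=x_n+\beta_n(x_n-x_{n-1}).$$ Suppose that the sequence $(x_n)_{n\in\mathbb N}$ is generated by one of the following two schemes (in the step size bounds a quotient with $L_g=0$ is read as $+\infty$): * (PADISNO) $f$ is bounded from below, $\alpha\in(-\frac12,\frac12)$, $0<s<\frac{1-2|\alpha|}{L_g(2|\beta|+1)}$, and $x_{n+1}\in\operatorname{argmin}_{u\in\mathbb R^m}\{f(u)+\langle\nabla g(z_n),u-y_n\rangle+\frac1{2s}\|u-y_n\|^2\}$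 for all $n\in\mathbb N$; * (c-PADISNO) $f$ is convex, $\alpha\in(-1,1)$, $0<s<\frac{2(1-|\alpha|)}{L_g(2|\beta|+1)}$, and $x_{n+1}=\operatorname{prox}_{sf}(y_n-s\nabla g(z_n))$ for all $n\in\mathbb N$, where $\operatorname{prox}_{sf}(u)=\operatorname{argmin}_{v\in\mathbb R^m}\{f(v)+\frac1{2s}\|v-u\|^2\}$. For a proper lower semicontinuous $F:\mathbb R^m\to\mathbb R\cup\{+\infty\}$ let $\partial F$ denote the limiting (Mordukhovich) subdifferential: $\partial F(u)=\emptyset$ if $F(u)=+\infty$, and otherwise $\partial F(u)$ is the set of limits of sequences $v_k\in\hat\partial F(u_k)$ with $u_k\to u$, $F(u_k)\to F(u)$, where $\hat\partial F(u)=\{v:\liminf_{w\to u,\,w\ne u}\frac{F(w)-F(u)-\langle v,w-u\rangle}{\|w-u\|}\ge0\}$ if $F(u)<+\infty$ and $\hat\partial F(u)=\emptyset$ otherwise. We say that $F$ has the Kurdyka-Łojasiewicz (KL) property at $\overline x$ with exponent $\theta\in[0,1)$ if $\partial F(\overline x)\ne\emptyset$ and there exist $K,\varepsilon>0$ and $\eta\in(0,+\infty]$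 such that $\operatorname{dist}(0,\partial F(u))\ge\frac1K(F(u)-F(\overline x))^\theta$ whenever $\|u-\overline x\|\le\varepsilon$ and $F(\overline x)<F(u)<F(\overline x)+\eta$ (with $\operatorname{dist}(0,\emptyset)=+\infty$). Assume that $f+g$ is bounded from below, that $x^*$ is a cluster point of $(x_n)_{n\in\mathbb N}$, and that $f+g$ has the KL property at $x^*$ with exponent $\theta\in[\frac12,1)$. Then the following hold. * If $\theta=\frac12$, then there exist $a_1>0$, $Q\in[0,1)$ and $\overline N\in\mathbb N$ such that for all $n\ge\overline N$ $$(f+g)(x_n)-(f+g)(x^*)\le a_1Q^n,\quad \|x_n-x^*\|\le a_1Q^{\frac n2},\quad \|y_n-x^*\|\le a_1Q^{\frac n2},\quad \|z_n-x^*\|\le a_1Q^{\frac n2}.$$ * If $\theta\in(\frac12,1)$, then there exist $a_2>0$ and $\overline N\in\mathbb N$ such that for all $n\ge\overline N$ $$(f+g)(x_n)-(f+g)(x^*)\le a_2n^{-\frac1{2\theta-1}},\quad \|x_n-x^*\|\le a_2n^{\frac{\theta-1}{2\theta-1}},\quad \|y_n-x^*\|\le a_2n^{\frac{\theta-1}{2\theta-1}},\quad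 \|z_n-x^*\|\le a_2n^{\frac{\theta-1}{2\theta-1}}.$$ -/

import Mathlib

open Filter Topology
open scoped NNReal

noncomputable section

namespace Padisno

section Subdifferential

variable {V : Type*} [NormedAddCommGroup V] [InnerProductSpace ℝ V]

/-- The Fréchet subdifferential of an extended-real-valued function at `x`; it is empty when `x`
is outside the domain `{F < +∞}`. The lower limit is over `y → x`, `y ≠ x`, taken in `EReal`. -/
def frechetSubdiff (F : V → EReal) (x : V) : Set V :=
  {v | F x < ⊤ ∧
    0 ≤ liminf (fun y => (F y - F x - ((inner ℝ v (y - x) : ℝ) : EReal)) / ((‖y - x‖ : ℝ) : EReal))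
      (𝓝[≠] x)}

/-- The limiting (Mordukhovich) subdifferential; it is empty outside the domain. -/
def limitingSubdiff (F : V → EReal) (x : V) : Set V :=
  {v | F x < ⊤ ∧ ∃ (p : ℕ → V) (w : ℕ → V),
    Tendsto p atTop (𝓝 x) ∧ Tendsto (fun k => F (p k)) atTop (𝓝 (F x)) ∧
    (∀ k, w k ∈ frechetSubdiff F (p k)) ∧ Tendsto w atTop (𝓝 v)}

/-- `F` has the Kurdyka-Łojasiewicz property at `xbar ∈ dom ∂F` with exponent `θ`:
`dist (0, ∂F x) ≥ (1 / K) (F x - F xbar) ^ θ` for all `x` with `‖x - xbar‖ ≤ ε` and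
`F xbar < F x < F xbar + η`, for some `K, ε > 0` and `η ∈ (0, +∞]`.
The distance is `[0, +∞]`-valued, so that the distance to the empty set is `+∞`; the difference
of the two values of `F` is a difference of real numbers. -/
def HasKLExponentAt (F : V → EReal) (xbar : V) (θ : ℝ) : Prop :=
  (limitingSubdiff F xbar).Nonempty ∧
  ∃ (K ε : ℝ) (η : EReal), 0 < K ∧ 0 < ε ∧ 0 < η ∧
    ∀ x : V, ‖x - xbar‖ ≤ ε → F xbar < F x → F x < F xbar + η →
      ENNReal.ofReal ((1 / K) * ((F x).toReal - (F xbar).toReal) ^ θ)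
        ≤ Metric.infEDist 0 (limitingSubdiff F x)

end Subdifferential

variable {m : ℕ}

/-- The data of the problem `inf (f + g)` on `ℝ^m`: `f` is proper and lower semicontinuous with
values in `ℝ ∪ {+∞}`, and `g` is differentiable with `L`-Lipschitz gradient. -/
structure IsProblem (f : EuclideanSpace ℝ (Fin m) → EReal) (g : EuclideanSpace ℝ (Fin m) → ℝ)
    (L : ℝ≥0) : Prop where
  ne_bot : ∀ u, f u ≠ ⊥
  proper : ∃ u, f u < ⊤
  lsc : LowerSemicontinuous f
  differentiable : Differentiable ℝ g
  lipschitz_gradient : LipschitzWith L (gradient g)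

/-- The objective function `f + g`. -/
def objective (f : EuclideanSpace ℝ (Fin m) → EReal) (g : EuclideanSpace ℝ (Fin m) → ℝ) :
    EuclideanSpace ℝ (Fin m) → EReal :=
  fun u => f u + (g u : EReal)

def BoundedFromBelow (F : EuclideanSpace ℝ (Fin m) → EReal) : Prop :=
  ∃ c : ℝ, ∀ u, (c : EReal) ≤ F u

/-- Convexity of a function with values in `ℝ ∪ {+∞}`. -/
def IsConvex (F : EuclideanSpace ℝ (Fin m) → EReal) : Prop :=
  ∀ u v : EuclideanSpace ℝ (Fin m), ∀ a b : ℝ, 0 < a → 0 < b → a + b = 1 →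
    F (a • u + b • v) ≤ (a : EReal) * F u + (b : EReal) * F v

/-- The inertial step `x_n + γ_n (x_n - x_{n-1})`. Since `0 - 1 = 0` in `ℕ`, the value at `n = 0`
is the one given by the convention `x_{-1} = x_0`. -/
def inertialStep (γ : ℕ → ℝ) (x : ℕ → EuclideanSpace ℝ (Fin m)) (n : ℕ) :
    EuclideanSpace ℝ (Fin m) :=
  x n + γ n • (x n - x (n - 1))

/-- `p` is the value at `u` of the proximal operator of `s f`, i.e. a minimizer of
`v ↦ f v + ‖v - u‖ ^ 2 / (2 s)` (for proper, lower semicontinuous and convex `f` there is exactly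
one). -/
def IsProx (s : ℝ) (f : EuclideanSpace ℝ (Fin m) → EReal) (u p : EuclideanSpace ℝ (Fin m)) :
    Prop :=
  ∀ v, f p + ((1 / (2 * s) * ‖p - u‖ ^ 2 : ℝ) : EReal)
    ≤ f v + ((1 / (2 * s) * ‖v - u‖ ^ 2 : ℝ) : EReal)

/-- The sequences `x, y, z` are generated by PADISNO, under the assumptions on `f` and on the
parameters that belong to it. The step size condition `s < (1 - 2|a|) / (L (2|b| + 1))` is written
without the quotient, so that for `L = 0` the bound is `+∞`. -/
structure IsPADISNO (f : EuclideanSpace ℝ (Fin m) → EReal) (g : EuclideanSpace ℝ (Fin m) → ℝ)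
    (L : ℝ≥0) (α β : ℕ → ℝ) (s : ℝ) (x y z : ℕ → EuclideanSpace ℝ (Fin m)) : Prop where
  bounded_below : BoundedFromBelow f
  parameters : ∃ a b : ℝ, Tendsto α atTop (𝓝 a) ∧ Tendsto β atTop (𝓝 b) ∧
    a ∈ Set.Ioo (-(1 / 2) : ℝ) (1 / 2) ∧ 0 < s ∧ s * ((L : ℝ) * (2 * |b| + 1)) < 1 - 2 * |a|
  y_eq : ∀ n, y n = inertialStep α x n
  z_eq : ∀ n, z n = inertialStep β x n
  x_argmin : ∀ n, ∀ v,
    f (x (n + 1)) + ((inner ℝ (gradient g (z n)) (x (n + 1) - y n)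
        + 1 / (2 * s) * ‖x (n + 1) - y n‖ ^ 2 : ℝ) : EReal)
      ≤ f v + ((inner ℝ (gradient g (z n)) (v - y n) + 1 / (2 * s) * ‖v - y n‖ ^ 2 : ℝ) : EReal)

/-- The sequences `x, y, z` are generated by c-PADISNO, under the assumptions on `f` and on the
parameters that belong to it. The step size condition `s < 2 (1 - |a|) / (L (2|b| + 1))` is written
without the quotient, so that for `L = 0` the bound is `+∞`. -/
structure IsConvexPADISNO (f : EuclideanSpace ℝ (Fin m) → EReal)
    (g : EuclideanSpace ℝ (Fin m) → ℝ) (L : ℝ≥0) (α β : ℕ → ℝ) (s : ℝ)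
    (x y z : ℕ → EuclideanSpace ℝ (Fin m)) : Prop where
  convex : IsConvex f
  parameters : ∃ a b : ℝ, Tendsto α atTop (𝓝 a) ∧ Tendsto β atTop (𝓝 b) ∧
    a ∈ Set.Ioo (-1 : ℝ) 1 ∧ 0 < s ∧ s * ((L : ℝ) * (2 * |b| + 1)) < 2 * (1 - |a|)
  y_eq : ∀ n, y n = inertialStep α x n
  z_eq : ∀ n, z n = inertialStep β x n
  x_prox : ∀ n, IsProx s f (y n - s • gradient g (z n)) (x (n + 1))

/-- `p` is a cluster point of the sequence `x`: the limit of some subsequence. -/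
def IsSeqClusterPt (x : ℕ → EuclideanSpace ℝ (Fin m)) (p : EuclideanSpace ℝ (Fin m)) : Prop :=
  ∃ φ : ℕ → ℕ, StrictMono φ ∧ Tendsto (fun k => x (φ k)) atTop (𝓝 p)

end Padisno

end

/-!
Both schemes choose `x_{n+1}` so that `s⁻¹ (y_n - x_{n+1}) - ∇g (z_n)` is a subgradient of `f` up to
a quadratic error of curvature `ρ`, where `ρ = 1 / s` for PADISNO and `ρ = 0` for c-PADISNO. Testing
it at `x_n` and using the descent lemma for `g`, the step size condition makes the energy
`(f + g) (x_n) + C ‖x_n - x_{n-1}‖ ^ 2` decrease by a multiple of `e_n ^ 2`, where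
`e_n = ‖x_n - x_{n-1}‖ + ‖x_{n+1} - x_n‖`, while `f + g` has a subgradient of size `O(e_n)` at
`x_{n+1}`. Hence near the cluster point the KL inequality bounds the `θ`-th power of the energy gap
`h_{n+1}` by `O(e_n)`. By concavity of `t ↦ t ^ (1 - θ)` this makes the lengths `e_n` summable, so
the iterates stay near the cluster point, at distance `O(h_n ^ (1 - θ))`. Inserting the bound back
into the decrease gives `h_{n+1} + κ h_{n+1} ^ (2θ) ≤ h_n`, and this recursion yields the rates.
-/

namespace Padisno

section Rates

variable {h : ℕ → ℝ}

lemma exists_eventually_le_mul_pow {Q : ℝ} (hQ : 0 < Q)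
    (hstep : ∀ᶠ n in atTop, h (n + 1) ≤ Q * h n) :
    ∃ C > 0, ∀ᶠ n in atTop, h n ≤ C * Q ^ n := by
  obtain ⟨N, hN⟩ := eventually_atTop.1 hstep
  refine ⟨(|h N| + 1) / Q ^ N, by positivity, eventually_atTop.2 ⟨N, fun n hn => ?_⟩⟩
  induction n, hn using Nat.le_induction with
  | base =>
    rw [div_mul_cancel₀ _ (pow_pos hQ N).ne']
    linarith [le_abs_self (h N)]
  | succ n hn ih =>
    calc h (n + 1) ≤ Q * h n := hN n hn
      _ ≤ Q * ((|h N| + 1) / Q ^ N * Q ^ n) := by gcongr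
      _ = (|h N| + 1) / Q ^ N * Q ^ (n + 1) := by ring

lemma exists_eventually_le_div_natCast {c : ℝ} (hc : 0 < c)
    (hstep : ∀ᶠ n in atTop, h (n + 1) * (1 + c * h (n + 1)) ≤ h n) :
    ∃ C > 0, ∀ᶠ n : ℕ in atTop, h n ≤ C / n := by
  obtain ⟨N, hN⟩ := eventually_atTop.1 hstep
  obtain ⟨B, hNB, hcB⟩ : ∃ B, h N ≤ B ∧ 2 / c ≤ B := ⟨_, le_max_left _ _, le_max_right _ _⟩
  have hB : 0 < B := (div_pos two_pos hc).trans_le hcB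
  have hcB : 2 ≤ c * B := by rwa [div_le_iff₀' hc] at hcB
  have hbound (j : ℕ) : h (N + j) ≤ B / (j + 1) := by
    induction j with
    | zero => simpa using hNB
    | succ j ih =>
      by_contra! hlt
      rw [Nat.cast_succ, add_assoc, one_add_one_eq_two, ← add_assoc] at hlt
      have hgrow : B / (j + 1) ≤ B / (j + 2) * (1 + c * (B / (j + 2))) :=
        calc B / (j + 1) ≤ B / (j + 2) * (1 + 2 / (j + 2)) := by
              rw [div_mul_eq_mul_div, div_le_div_iff₀ (by positivity) (by positivity), mul_assoc]
              gcongr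
              rw [one_add_div (by positivity), div_mul_eq_mul_div, le_div_iff₀ (by positivity)]
              nlinarith [(j.cast_nonneg : (0 : ℝ) ≤ j)]
          _ ≤ B / (j + 2) * (1 + c * (B / (j + 2))) := by rw [← mul_div_assoc c]; gcongr
      have hgt : B / (j + 2) * (1 + c * (B / (j + 2)))
          < h (N + j + 1) * (1 + c * h (N + j + 1)) := by gcongr
      linarith [hN (N + j) (by lia)]
  refine ⟨B * (N + 1), by positivity, eventually_atTop.2 ⟨N + 1, fun n hn => ?_⟩⟩
  obtain ⟨j, rfl⟩ := Nat.exists_eq_add_of_le (show N ≤ n by lia)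
  refine (hbound j).trans ?_
  have hj : (0 : ℝ) < (N + j : ℕ) := by exact_mod_cast (by lia : 0 < N + j)
  rw [div_le_div_iff₀ (by positivity) hj, mul_assoc]
  push_cast
  gcongr
  nlinarith [mul_nonneg (N.cast_nonneg : (0 : ℝ) ≤ N) (j.cast_nonneg : (0 : ℝ) ≤ j)]

lemma one_add_half_mul_le_rpow {u q : ℝ} (hu : u ∈ Set.Icc 0 1) (hq : 0 ≤ q) :
    1 + q / 2 * u ≤ (1 + u) ^ q := by
  obtain ⟨hu0, hu1⟩ := hu
  have hlog : u / 2 ≤ Real.log (1 + u) :=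
    calc u / 2 ≤ u / (1 + u) := by gcongr; linarith
      _ = 1 - (1 + u)⁻¹ := by field_simp; ring
      _ ≤ Real.log (1 + u) := Real.one_sub_inv_le_log_of_pos (by linarith)
  calc 1 + q / 2 * u = u / 2 * q + 1 := by ring
    _ ≤ Real.log (1 + u) * q + 1 := by gcongr
    _ ≤ Real.exp (Real.log (1 + u) * q) := Real.add_one_le_exp _
    _ = (1 + u) ^ q := (Real.rpow_def_of_pos (by linarith) q).symm

lemma rpow_mul_one_add_le_rpow {a b κ q : ℝ} (hb : 0 ≤ b) (hκ : 0 ≤ κ) (hq : 0 < q)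
    (hab : b + κ * b ^ (1 + q) ≤ a) (hsmall : κ * b ^ q ≤ 1) :
    b ^ q * (1 + q / 2 * κ * b ^ q) ≤ a ^ q := by
  calc b ^ q * (1 + q / 2 * κ * b ^ q) ≤ b ^ q * (1 + κ * b ^ q) ^ q := by
        rw [mul_assoc (q / 2)]
        gcongr
        exact one_add_half_mul_le_rpow ⟨by positivity, hsmall⟩ hq.le
    _ = (b + κ * b ^ (1 + q)) ^ q := by
        rw [← Real.mul_rpow hb (by positivity), Real.rpow_one_add' hb (by positivity)]
        ring_nf
    _ ≤ a ^ q := by gcongr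

lemma exists_eventually_le_mul_rpow_neg {κ q : ℝ} (hκ : 0 < κ) (hq : 0 < q)
    (h0 : ∀ᶠ n in atTop, 0 ≤ h n) (hlim : Tendsto h atTop (𝓝 0))
    (hstep : ∀ᶠ n in atTop, h (n + 1) + κ * h (n + 1) ^ (1 + q) ≤ h n) :
    ∃ C > 0, ∀ᶠ n : ℕ in atTop, h n ≤ C * (n : ℝ) ^ (-(1 / q)) := by
  have hsmall : ∀ᶠ n in atTop, κ * h n ^ q ≤ 1 := by
    refine Tendsto.eventually_le_const (v := 0) one_pos ?_
    simpa [Real.zero_rpow hq.ne'] using (hlim.rpow_const (p := q) (.inr hq.le)).const_mul κ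
  obtain ⟨C, hC, hCle⟩ := exists_eventually_le_div_natCast (h := fun n => h n ^ q)
    (c := q / 2 * κ) (by positivity) <| by
      filter_upwards [(tendsto_add_atTop_nat 1).eventually (h0.and hsmall), hstep]
        with n ⟨hpos, hle⟩ hn using rpow_mul_one_add_le_rpow hpos hκ.le hq hn hle
  refine ⟨C ^ (1 / q), by positivity, ?_⟩
  filter_upwards [h0, hCle] with n hn hle
  calc h n = (h n ^ q) ^ (1 / q) := by rw [one_div, Real.rpow_rpow_inv hn hq.ne']
    _ ≤ (C / n) ^ (1 / q) := by gcongr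
    _ = C ^ (1 / q) * (n : ℝ) ^ (-(1 / q)) := by
        rw [Real.div_rpow hC.le n.cast_nonneg, Real.rpow_neg n.cast_nonneg, div_eq_mul_inv]

lemma exists_eventually_le_mul_and_mul_rpow_le {ρ : ℕ → ℝ} {C c q : ℝ} (hC : 0 < C) (hc : 0 ≤ c)
    (hq : 0 ≤ q) (hρ : ∀ n, 0 ≤ ρ n) (h0 : ∀ᶠ n in atTop, 0 ≤ h n)
    (hle : ∀ᶠ n in atTop, h n ≤ C * ρ n) :
    ∃ a > 0, ∀ᶠ n in atTop, h n ≤ a * ρ n ∧ c * h n ^ q ≤ a * ρ n ^ q := by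
  have hCq : 0 ≤ c * C ^ q := by positivity
  refine ⟨C + c * C ^ q, by positivity, ?_⟩
  filter_upwards [h0, hle] with n hn hle
  have hρn := hρ n
  constructor
  · exact hle.trans (by gcongr; linarith)
  · calc c * h n ^ q ≤ c * (C * ρ n) ^ q := by gcongr
      _ = c * C ^ q * ρ n ^ q := by rw [Real.mul_rpow hC.le hρn, mul_assoc]
      _ ≤ (C + c * C ^ q) * ρ n ^ q := by gcongr; linarith

lemma exists_linear_rate {κ c : ℝ} (hκ : 0 < κ) (hc : 0 ≤ c) (h0 : ∀ᶠ n in atTop, 0 ≤ h n)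
    (hstep : ∀ᶠ n in atTop, h (n + 1) + κ * h (n + 1) ≤ h n) :
    ∃ a > 0, ∃ Q ∈ Set.Ico (0 : ℝ) 1, ∀ᶠ n : ℕ in atTop,
      h n ≤ a * Q ^ n ∧ c * h n ^ (1 / 2 : ℝ) ≤ a * Q ^ ((n : ℝ) / 2) := by
  have hQ : 0 < (1 + κ)⁻¹ := by positivity
  obtain ⟨C, hC, hle⟩ := exists_eventually_le_mul_pow hQ <| hstep.mono fun n hn => by
    rw [← div_eq_inv_mul, le_div_iff₀ (by positivity)]; linarith
  obtain ⟨a, ha, hrate⟩ := exists_eventually_le_mul_and_mul_rpow_le hC hc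
    (q := 1 / 2) (by norm_num) (fun n => pow_nonneg hQ.le n) h0 hle
  refine ⟨a, ha, (1 + κ)⁻¹, ⟨hQ.le, inv_lt_one_of_one_lt₀ (by linarith)⟩, ?_⟩
  filter_upwards [hrate] with n hn
  rwa [← Real.rpow_natCast_mul hQ.le, mul_one_div] at hn

lemma exists_sublinear_rate {κ c θ : ℝ} (hκ : 0 < κ) (hc : 0 ≤ c) (hθ : θ ∈ Set.Ioo (1 / 2) 1)
    (h0 : ∀ᶠ n in atTop, 0 ≤ h n) (hlim : Tendsto h atTop (𝓝 0))
    (hstep : ∀ᶠ n in atTop, h (n + 1) + κ * h (n + 1) ^ (2 * θ) ≤ h n) :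
    ∃ a > 0, ∀ᶠ n : ℕ in atTop, h n ≤ a * (n : ℝ) ^ (-(1 / (2 * θ - 1))) ∧
      c * h n ^ (1 - θ) ≤ a * (n : ℝ) ^ ((θ - 1) / (2 * θ - 1)) := by
  obtain ⟨hθ1, hθ2⟩ := hθ
  have hq : 0 < 2 * θ - 1 := by linarith
  obtain ⟨C, hC, hle⟩ := exists_eventually_le_mul_rpow_neg hκ hq h0 hlim (by simpa using hstep)
  obtain ⟨a, ha, hrate⟩ := exists_eventually_le_mul_and_mul_rpow_le hC hc
    (q := 1 - θ) (by linarith) (fun n => Real.rpow_nonneg n.cast_nonneg _) h0 hle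
  refine ⟨a, ha, ?_⟩
  filter_upwards [hrate] with n hn
  rwa [← Real.rpow_mul n.cast_nonneg,
    show -(1 / (2 * θ - 1)) * (1 - θ) = (θ - 1) / (2 * θ - 1) by ring] at hn

end Rates

section Descent

lemma eventually_le_of_frequently_lt {H : ℕ → ℝ} {b : ℝ}
    (hH : ∀ᶠ n in atTop, H (n + 1) ≤ H n) (hb : ∀ c < b, ∃ᶠ n in atTop, c < H n) :
    ∀ᶠ n in atTop, b ≤ H n := by
  obtain ⟨N, hN⟩ := eventually_atTop.1 hH
  refine eventually_atTop.2 ⟨N, fun n hn => le_of_forall_lt fun c hc => ?_⟩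
  obtain ⟨j, hnj, hj⟩ := (frequently_atTop.1 (hb c hc)) n
  exact hj.trans_le (Nat.rel_of_forall_rel_succ_of_le_of_le (· ≥ ·) hN hn hnj)

lemma exists_tendsto_of_eventually_antitone {H : ℕ → ℝ} {b : ℝ}
    (hH : ∀ᶠ n in atTop, H (n + 1) ≤ H n) (hb : ∀ᶠ n in atTop, b ≤ H n) :
    ∃ l, Tendsto H atTop (𝓝 l) := by
  obtain ⟨N, hN⟩ := eventually_atTop.1 (hH.and hb)
  have hanti : Antitone fun n => H (n + N) := antitone_nat_of_succ_le fun n => by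
    rw [Nat.succ_add_eq_add_succ]
    exact (hN (n + N) (N.le_add_left n)).1
  refine ⟨_, (tendsto_add_atTop_iff_nat N).1 (tendsto_atTop_ciInf hanti ⟨b, ?_⟩)⟩
  rintro _ ⟨n, rfl⟩
  exact (hN (n + N) (N.le_add_left n)).2

lemma tendsto_zero_of_sufficient_decrease {H e : ℕ → ℝ} {D l : ℝ} (hD : 0 < D)
    (hdesc : ∀ᶠ n in atTop, H (n + 1) + D * e n ^ 2 ≤ H n) (hl : Tendsto H atTop (𝓝 l)) :
    Tendsto e atTop (𝓝 0) := by
  have hdiff : Tendsto (fun n => √((H n - H (n + 1)) / D)) atTop (𝓝 0) := by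
    simpa using ((hl.sub (hl.comp (tendsto_add_atTop_nat 1))).div_const D).sqrt
  refine squeeze_zero_norm' ?_ hdiff
  filter_upwards [hdesc] with n hn
  refine Real.abs_le_sqrt ?_
  rw [le_div_iff₀' hD]
  linarith

lemma one_sub_mul_sub_le_rpow_mul {a b θ : ℝ} (ha : 0 ≤ a) (hb : 0 ≤ b) (hθ : θ ∈ Set.Icc 0 1) :
    (1 - θ) * (a - b) ≤ a ^ θ * (a ^ (1 - θ) - b ^ (1 - θ)) := by
  have hamgm : a ^ θ * b ^ (1 - θ) ≤ θ * a + (1 - θ) * b :=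
    Real.geom_mean_le_arith_mean2_weighted hθ.1 (sub_nonneg.2 hθ.2) ha hb (by ring)
  have hsplit : a ^ θ * a ^ (1 - θ) = a := by
    rw [← Real.rpow_add' ha (by norm_num), add_sub_cancel, Real.rpow_one]
  linarith

lemma two_mul_le_add_of_kl {a b e e' D E θ : ℝ} (hb : 0 ≤ b) (he : 0 ≤ e) (hD : 0 < D)
    (hE : 0 ≤ E) (hθ : θ ∈ Set.Ico 0 1) (hKL : a ^ θ ≤ E * e) (hdesc : b + D * e' ^ 2 ≤ a) :
    2 * e' ≤ e + E / (D * (1 - θ)) * (a ^ (1 - θ) - b ^ (1 - θ)) := by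
  have h1θ : 0 < 1 - θ := sub_pos.2 hθ.2
  have hba : b ≤ a := by linarith [mul_nonneg hD.le (sq_nonneg e')]
  have hφ : 0 ≤ a ^ (1 - θ) - b ^ (1 - θ) := sub_nonneg.2 (by gcongr)
  refine two_mul_le_add_of_sq_le_mul he (by positivity) ?_
  have hsq : D * (1 - θ) * e' ^ 2 ≤ E * e * (a ^ (1 - θ) - b ^ (1 - θ)) :=
    calc D * (1 - θ) * e' ^ 2 = (1 - θ) * (D * e' ^ 2) := by ring
      _ ≤ (1 - θ) * (a - b) := by gcongr; linarith
      _ ≤ a ^ θ * (a ^ (1 - θ) - b ^ (1 - θ)) :=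
        one_sub_mul_sub_le_rpow_mul (hb.trans hba) hb ⟨hθ.1, hθ.2.le⟩
      _ ≤ E * e * (a ^ (1 - θ) - b ^ (1 - θ)) := by gcongr
  calc e' ^ 2 ≤ E * e * (a ^ (1 - θ) - b ^ (1 - θ)) / (D * (1 - θ)) := by
        rwa [le_div_iff₀' (by positivity)]
    _ = e * (E / (D * (1 - θ)) * (a ^ (1 - θ) - b ^ (1 - θ))) := by ring

lemma le_sqrt_mul_rpow_of_descent {a b e D q : ℝ} (hb : 0 ≤ b) (hD : 0 < D)
    (hq : q ∈ Set.Icc 0 (1 / 2)) (ha : a ≤ 1) (hdesc : b + D * e ^ 2 ≤ a) :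
    e ≤ √(1 / D) * a ^ q := by
  have ha0 : 0 ≤ a := by linarith [mul_nonneg hD.le (sq_nonneg e)]
  calc e ≤ √(1 / D * a) := Real.le_sqrt_of_sq_le <| by
        rw [one_div_mul_eq_div, le_div_iff₀' hD]; linarith
    _ = √(1 / D) * a ^ (1 / 2 : ℝ) := by rw [Real.sqrt_mul (by positivity), Real.sqrt_eq_rpow a]
    _ ≤ √(1 / D) * a ^ q := by
        gcongr √(1 / D) * ?_
        exact Real.rpow_le_rpow_of_exponent_ge' ha0 ha hq.1 hq.2

lemma add_mul_rpow_le_of_kl {a b e D E θ : ℝ} (hb : 0 ≤ b) (hD : 0 ≤ D) (hE : 0 < E)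
    (hKL : b ^ θ ≤ E * e) (hdesc : b + D * e ^ 2 ≤ a) :
    b + D / E ^ 2 * b ^ (2 * θ) ≤ a := by
  have hsq : b ^ (2 * θ) ≤ (E * e) ^ 2 := by
    rw [mul_comm, Real.rpow_mul hb, Real.rpow_two]
    gcongr
  calc b + D / E ^ 2 * b ^ (2 * θ) ≤ b + D / E ^ 2 * (E * e) ^ 2 := by gcongr
    _ = b + D * e ^ 2 := by field_simp
    _ ≤ a := hdesc

variable {X : Type*} [PseudoMetricSpace X] {u : ℕ → X} {p : X}

lemma dist_add_le_of_forall_dist_succ_add_le {T : ℕ → ℝ} {N : ℕ}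
    (hstep : ∀ n ≥ N, dist (u n) (u (n + 1)) + T (n + 1) ≤ T n) {j n : ℕ} (hn : N ≤ n)
    (hj : n ≤ j) : dist (u n) (u j) + T j ≤ T n := by
  induction j, hj using Nat.le_induction with
  | base => simp
  | succ j hj ih => linarith [hstep j (hn.trans hj), dist_triangle (u n) (u j) (u (j + 1))]

lemma eventually_dist_le_of_trapped {T : ℕ → ℝ} {ε : ℝ} (hp : MapClusterPt p atTop u)
    (hε : 0 < ε) (h0 : ∀ᶠ n in atTop, 0 ≤ T n) (hlim : Tendsto T atTop (𝓝 0))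
    (hstep : ∀ᶠ n in atTop, dist (u n) p ≤ ε → dist (u n) (u (n + 1)) + T (n + 1) ≤ T n) :
    ∀ᶠ n in atTop, dist (u n) p ≤ T n := by
  obtain ⟨N, hN⟩ := eventually_atTop.1 (h0.and hstep)
  obtain ⟨P, hPε, hP, hNP⟩ : ∃ P, dist (u P) p < ε / 2 ∧ T P ≤ ε / 2 ∧ N ≤ P :=
    ((hp.frequently (Metric.ball_mem_nhds p (half_pos hε))).and_eventually
      ((hlim.eventually_le_const (half_pos hε)).and (eventually_ge_atTop N))).exists
  have hball : ∀ n ≥ P, dist (u n) p + T n ≤ ε := by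
    intro n hn
    induction n, hn using Nat.le_induction with
    | base => linarith
    | succ n hn ih =>
      obtain ⟨hTn, hn'⟩ := hN n (hNP.trans hn)
      linarith [hn' (by linarith), dist_triangle_left (u (n + 1)) p (u n)]
  have hstep' : ∀ n ≥ P, dist (u n) (u (n + 1)) + T (n + 1) ≤ T n := fun n hn => by
    obtain ⟨hTn, hn'⟩ := hN n (hNP.trans hn)
    exact hn' (by linarith [hball n hn])
  refine eventually_atTop.2 ⟨P, fun n hn => le_of_forall_pos_le_add fun δ hδ => ?_⟩
  obtain ⟨j, hjδ, hj⟩ : ∃ j, dist (u j) p < δ ∧ n ≤ j :=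
    ((hp.frequently (Metric.ball_mem_nhds p hδ)).and_eventually (eventually_ge_atTop n)).exists
  have htail := dist_add_le_of_forall_dist_succ_add_le hstep' hn hj
  linarith [(hN j (hNP.trans (hn.trans hj))).1, dist_triangle (u n) (u j) p]

variable {h e : ℕ → ℝ} {D E ε θ : ℝ}

lemma exists_eventually_dist_le_of_descent (hp : MapClusterPt p atTop u) (hD : 0 < D)
    (hE : 0 ≤ E) (hε : 0 < ε) (hθ : θ ∈ Set.Ico (1 / 2 : ℝ) 1)
    (he : ∀ n, dist (u n) (u (n + 1)) ≤ e n) (h0 : ∀ᶠ n in atTop, 0 ≤ h n)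
    (hlim : Tendsto h atTop (𝓝 0)) (hdesc : ∀ᶠ n in atTop, h (n + 1) + D * e n ^ 2 ≤ h n)
    (hKL : ∀ᶠ n in atTop, dist (u (n + 1)) p ≤ ε → h (n + 1) ^ θ ≤ E * e n) :
    ∃ c > 0, ∀ᶠ n in atTop, e n ≤ c * h n ^ (1 - θ) ∧ dist (u n) p ≤ c * h n ^ (1 - θ) := by
  have h1θ : 0 < 1 - θ := sub_pos.2 hθ.2
  have he0 (n : ℕ) : 0 ≤ e n := dist_nonneg.trans (he n)
  set M := E / (D * (1 - θ))
  have hsucc := tendsto_add_atTop_nat 1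
  have helim := tendsto_zero_of_sufficient_decrease hD hdesc hlim
  have hdist : ∀ᶠ n in atTop, dist (u (n + 1)) p ≤ e n + M * h (n + 1) ^ (1 - θ) := by
    refine eventually_dist_le_of_trapped (u := fun n => u (n + 1)) ?_ hε ?_ ?_ ?_
    · rwa [MapClusterPt, ← Function.comp_def, ← map_map, map_add_atTop_eq_nat]
    · filter_upwards [hsucc.eventually h0] with n hn
      have := he0 n
      positivity
    · simpa [h1θ.ne'] using
        helim.add (((hlim.comp hsucc).rpow_const (p := 1 - θ) (.inr h1θ.le)).const_mul M)
    · filter_upwards [hKL, hsucc.eventually hdesc, (tendsto_add_atTop_nat 2).eventually h0]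
        with n hKLn hdescn h0n hball
      have htwo := two_mul_le_add_of_kl h0n (he0 n) hD hE ⟨by linarith [hθ.1], hθ.2⟩
        (hKLn hball) hdescn
      linarith [he (n + 1)]
  refine ⟨2 * √(1 / D) + M, by positivity, ?_⟩
  filter_upwards [hdist, hdesc, h0, hsucc.eventually h0, hlim.eventually_le_const one_pos]
    with n hdistn hdescn h0n h0n' h1n
  have hen := le_sqrt_mul_rpow_of_descent h0n' hD ⟨h1θ.le, by linarith [hθ.1]⟩ h1n hdescn
  have hmono : h (n + 1) ≤ h n := by linarith [mul_nonneg hD.le (sq_nonneg (e n))]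
  have hMmono : M * h (n + 1) ^ (1 - θ) ≤ M * h n ^ (1 - θ) := by gcongr
  have hMh : 0 ≤ M * h n ^ (1 - θ) := by positivity
  rw [add_mul, mul_assoc]
  constructor <;> linarith [he n, he0 n, dist_triangle (u n) (u (n + 1)) p]

lemma exists_rate_of_descent (hp : MapClusterPt p atTop u) (hD : 0 < D) (hE : 0 < E)
    (hε : 0 < ε) (hθ : θ ∈ Set.Ico (1 / 2 : ℝ) 1) (he : ∀ n, dist (u n) (u (n + 1)) ≤ e n)
    (h0 : ∀ᶠ n in atTop, 0 ≤ h n) (hlim : Tendsto h atTop (𝓝 0))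
    (hdesc : ∀ᶠ n in atTop, h (n + 1) + D * e n ^ 2 ≤ h n)
    (hKL : ∀ᶠ n in atTop, dist (u (n + 1)) p ≤ ε → h (n + 1) ^ θ ≤ E * e n) :
    ∃ κ > 0, ∃ c > 0, ∀ᶠ n in atTop, h (n + 1) + κ * h (n + 1) ^ (2 * θ) ≤ h n ∧
      e n ≤ c * h n ^ (1 - θ) ∧ dist (u n) p ≤ c * h n ^ (1 - θ) := by
  have h1θ : 0 < 1 - θ := sub_pos.2 hθ.2
  obtain ⟨c, hc, hdist⟩ :=
    exists_eventually_dist_le_of_descent hp hD hE.le hε hθ he h0 hlim hdesc hKL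
  have hclim : Tendsto (fun n => c * h n ^ (1 - θ)) atTop (𝓝 0) := by
    simpa [h1θ.ne'] using (hlim.rpow_const (p := 1 - θ) (.inr h1θ.le)).const_mul c
  refine ⟨D / E ^ 2, by positivity, c, hc, ?_⟩
  have hsucc := tendsto_add_atTop_nat 1
  filter_upwards [hdist, hsucc.eventually hdist, hsucc.eventually (hclim.eventually_le_const hε),
    hsucc.eventually h0, hdesc, hKL] with n hn hn' hballn h0n hdescn hKLn
  exact ⟨add_mul_rpow_le_of_kl h0n hD.le hE (hKLn (hn'.2.trans hballn)) hdescn, hn⟩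

lemma rpow_add_mul_sq_le {C θ t d B : ℝ} (hC : 0 ≤ C) (hθ : θ ∈ Set.Icc (1 / 2 : ℝ) 1)
    (hd : d ∈ Set.Icc (0 : ℝ) 1) (h0 : 0 ≤ t + C * d ^ 2) (hB : 0 ≤ B)
    (ht : 0 < t → t ^ θ ≤ B) : (t + C * d ^ 2) ^ θ ≤ B + C ^ θ * d := by
  have hθ0 : 0 ≤ θ := by linarith [hθ.1]
  have hsq : (C * d ^ 2) ^ θ ≤ C ^ θ * d := by
    rw [Real.mul_rpow hC (sq_nonneg d), ← Real.rpow_natCast_mul hd.1]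
    gcongr
    exact Real.rpow_le_self_of_le_one hd.1 hd.2 (by push_cast; linarith [hθ.1])
  rcases le_or_gt t 0 with ht0 | ht0
  · calc (t + C * d ^ 2) ^ θ ≤ (C * d ^ 2) ^ θ := by gcongr; linarith
      _ ≤ B + C ^ θ * d := hsq.trans (le_add_of_nonneg_left hB)
  · calc (t + C * d ^ 2) ^ θ ≤ t ^ θ + (C * d ^ 2) ^ θ :=
          Real.rpow_add_le_add_rpow ht0.le (by positivity) hθ0 hθ.2
      _ ≤ B + C ^ θ * d := add_le_add (ht ht0) hsq

end Descent

section ExtendedReals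

variable {a b : EReal} {r t : ℝ}

lemma add_coe_sub_le_of_add_coe_le_add_coe (h : a + r ≤ b + t) : a + ((r - t : ℝ) : EReal) ≤ b :=
  calc a + ((r - t : ℝ) : EReal) = a + r - t := by
        rw [EReal.coe_sub, sub_eq_add_neg, sub_eq_add_neg, add_assoc]
    _ ≤ b + t - t := EReal.sub_le_sub h le_rfl
    _ = b := EReal.add_sub_cancel_right

lemma add_coe_add_coe_le_add_coe {r' t' : ℝ} (h : a + r ≤ b) (ht : t + (r' - r) ≤ t') :
    a + t + r' ≤ b + t' :=
  calc a + t + r' = a + ((t + r' : ℝ) : EReal) := by rw [add_assoc, EReal.coe_add]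
    _ ≤ a + ((r + t' : ℝ) : EReal) :=
      add_le_add le_rfl (EReal.coe_le_coe_iff.2 (by linarith))
    _ = a + r + t' := by rw [EReal.coe_add, add_assoc]
    _ ≤ b + t' := by gcongr

lemma ne_top_of_add_coe_le (h : a + r ≤ b) (hb : b ≠ ⊤) : a ≠ ⊤ := by
  rintro rfl
  exact hb (top_le_iff.1 (EReal.top_add_coe r ▸ h))

lemma toReal_add_le_toReal_of_add_coe_le (ha : a ≠ ⊥) (hb : b ≠ ⊤) (h : a + r ≤ b) :
    a.toReal + r ≤ b.toReal := by
  have htop := ne_top_of_add_coe_le h hb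
  rw [← EReal.toReal_coe r, ← EReal.toReal_add htop ha (EReal.coe_ne_top r) (EReal.coe_ne_bot r)]
  exact EReal.toReal_le_toReal h (by simp [ha]) hb

variable {X : Type*}

lemma eventually_lt_toReal [TopologicalSpace X] {F : X → EReal} {p : X} {c : ℝ}
    (hF : LowerSemicontinuousAt F p) (hbot : F p ≠ ⊥) (hp : F p ≠ ⊤) (hc : c < (F p).toReal) :
    ∀ᶠ u in 𝓝 p, F u ≠ ⊤ → c < (F u).toReal := by
  have hc' : (c : EReal) < F p := by
    rw [← EReal.coe_toReal hp hbot]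
    exact_mod_cast hc
  filter_upwards [hF c hc'] with u hu htop
  rwa [← EReal.coe_toReal htop (bot_le.trans_lt hu).ne', gt_iff_lt, EReal.coe_lt_coe_iff] at hu

/-- The objective `f + g` of a composite problem; `objective` is its instance on `ℝ^m`. -/
noncomputable def compositeObjective (f : X → EReal) (g : X → ℝ) : X → EReal :=
  fun u => f u + (g u : EReal)

lemma compositeObjective_ne_bot {f : X → EReal} {u : X} (g : X → ℝ) (hu : f u ≠ ⊥) :
    compositeObjective f g u ≠ ⊥ :=
  fun h => (EReal.add_eq_bot_iff.1 h).elim hu (EReal.coe_ne_bot _)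

lemma lowerSemicontinuousAt_compositeObjective [TopologicalSpace X] {f : X → EReal} {g : X → ℝ}
    {p : X} (hf : LowerSemicontinuousAt f p) (hg : ContinuousAt g p) :
    LowerSemicontinuousAt (compositeObjective f g) p :=
  hf.add' (continuous_coe_real_ereal.continuousAt.comp hg).lowerSemicontinuousAt
    (EReal.continuousAt_add (Or.inr (EReal.coe_ne_bot _)) (Or.inr (EReal.coe_ne_top _)))

end ExtendedReals

section Smooth

variable {V : Type*} [NormedAddCommGroup V] [InnerProductSpace ℝ V] [CompleteSpace V]

lemma hasDerivAt_comp_add_smul {g : V → ℝ} (hg : Differentiable ℝ g) (u w : V) (t : ℝ) :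
    HasDerivAt (fun t : ℝ => g (u + t • w)) (inner ℝ (gradient g (u + t • w)) w) t := by
  have hline : HasDerivAt (fun t : ℝ => u + t • w) w t := by
    simpa using ((hasDerivAt_id t).smul_const w).const_add u
  have hcomp := (hg (u + t • w)).hasGradientAt.hasFDerivAt.comp_hasDerivAt t hline
  rwa [InnerProductSpace.toDual_apply_apply] at hcomp

lemma abs_sub_sub_inner_gradient_le {g : V → ℝ} {L : ℝ≥0} (hg : Differentiable ℝ g)
    (hL : LipschitzWith L (gradient g)) (u v : V) :
    |g v - g u - inner ℝ (gradient g u) (v - u)| ≤ L / 2 * ‖v - u‖ ^ 2 := by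
  obtain ⟨w, rfl⟩ : ∃ w, v = u + w := ⟨v - u, by abel⟩
  have hderiv (t : ℝ) :
      HasDerivAt (fun t : ℝ => g (u + t • w) - g u - t * inner ℝ (gradient g u) w)
        (inner ℝ (gradient g (u + t • w) - gradient g u) w) t := by
    rw [inner_sub_left]
    exact ((hasDerivAt_comp_add_smul hg u w t).sub_const (g u)).sub (hasDerivAt_mul_const _)
  have hbound (t : ℝ) : HasDerivAt (fun t : ℝ => L / 2 * ‖w‖ ^ 2 * t ^ 2) (L * t * ‖w‖ ^ 2) t := by
    have hpow := (hasDerivAt_pow 2 t).const_mul (L / 2 * ‖w‖ ^ 2)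
    rwa [show L / 2 * ‖w‖ ^ 2 * ((2 : ℕ) * t ^ (2 - 1)) = L * t * ‖w‖ ^ 2 by push_cast; ring]
      at hpow
  have hle : ∀ t ∈ Set.Ico (0 : ℝ) 1,
      ‖(inner ℝ (gradient g (u + t • w) - gradient g u) w : ℝ)‖ ≤ L * t * ‖w‖ ^ 2 := by
    rintro t ⟨ht, -⟩
    calc ‖(inner ℝ (gradient g (u + t • w) - gradient g u) w : ℝ)‖
        ≤ ‖gradient g (u + t • w) - gradient g u‖ * ‖w‖ := norm_inner_le_norm _ _
      _ ≤ L * ‖u + t • w - u‖ * ‖w‖ := by gcongr; exact hL.norm_sub_le _ _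
      _ = L * t * ‖w‖ ^ 2 := by
        rw [add_sub_cancel_left, norm_smul, Real.norm_of_nonneg ht]; ring
  have := image_norm_le_of_norm_deriv_right_le_deriv_boundary
    (fun t _ => (hderiv t).continuousAt.continuousWithinAt)
    (fun t _ => (hderiv t).hasDerivWithinAt) (by simp) hbound hle
    (Set.right_mem_Icc.2 zero_le_one)
  simpa using this

end Smooth

section Subgradients

variable {V : Type*} [NormedAddCommGroup V] [InnerProductSpace ℝ V]

lemma norm_sub_sq_eq_add_inner_add (u v p : V) :
    ‖v - u‖ ^ 2 = ‖p - u‖ ^ 2 - 2 * inner ℝ (u - p) (v - p) + ‖v - p‖ ^ 2 := by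
  rw [← sub_sub_sub_cancel_right v u p, norm_sub_sq_real, norm_sub_rev u p, real_inner_comm]
  ring

/-- `w` is a proximal subgradient of `F` at `p` with curvature `ρ`: the quadratic function with
slope `w` and curvature `-ρ` at `p` that agrees with `F` at `p` minorizes `F`. At a point where
`F` is finite, `ρ = 0` gives the subgradients of convex analysis. -/
def IsProxSubgradient (F : V → EReal) (ρ : ℝ) (p w : V) : Prop :=
  ∀ v, F p + ((inner ℝ w (v - p) - ρ / 2 * ‖v - p‖ ^ 2 : ℝ) : EReal) ≤ F v

variable {F f : V → EReal} {ρ θ : ℝ} {p w : V}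

lemma IsProxSubgradient.ne_bot (h : IsProxSubgradient F ρ p w) (hp : F p ≠ ⊥) (v : V) :
    F v ≠ ⊥ := fun hv =>
  (EReal.add_eq_bot_iff.1 (le_bot_iff.1 (hv ▸ h v))).elim hp (EReal.coe_ne_bot _)

lemma IsProxSubgradient.toReal_add_le (h : IsProxSubgradient F ρ p w) (hp : F p ≠ ⊥) {v : V}
    (hv : F v ≠ ⊤) :
    (F p).toReal + (inner ℝ w (v - p) - ρ / 2 * ‖v - p‖ ^ 2) ≤ (F v).toReal :=
  toReal_add_le_toReal_of_add_coe_le hp hv (h v)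

lemma isProxSubgradient_of_forall_add_le {q : V → ℝ}
    (hmin : ∀ v, F p + (q p : EReal) ≤ F v + (q v : EReal))
    (hq : ∀ v, q v = q p - inner ℝ w (v - p) + ρ / 2 * ‖v - p‖ ^ 2) :
    IsProxSubgradient F ρ p w := fun v => by
  have h := add_coe_sub_le_of_add_coe_le_add_coe (hmin v)
  rwa [show q p - q v = inner ℝ w (v - p) - ρ / 2 * ‖v - p‖ ^ 2 by rw [hq v]; ring] at h

lemma IsProxSubgradient.add_gradient [CompleteSpace V] {g : V → ℝ} {L : ℝ≥0}
    (h : IsProxSubgradient f ρ p w) (hg : Differentiable ℝ g) (hL : LipschitzWith L (gradient g)) :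
    IsProxSubgradient (compositeObjective f g) (ρ + L) p (w + gradient g p) := fun v => by
  have hgv := (abs_le.1 (abs_sub_sub_inner_gradient_le hg hL p v)).1
  refine add_coe_add_coe_le_add_coe (h v) ?_
  rw [inner_add_left]
  linarith

lemma IsProxSubgradient.mem_frechetSubdiff (h : IsProxSubgradient F ρ p w) (hbot : F p ≠ ⊥)
    (htop : F p ≠ ⊤) : w ∈ frechetSubdiff F p := by
  refine ⟨htop.lt_top, le_of_forall_lt fun c hc => ?_⟩
  obtain ⟨δ, hcδ, hδ⟩ := EReal.lt_iff_exists_real_btwn.1 hc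
  refine hcδ.trans_le (le_liminf_of_le (by isBoundedDefault) ?_)
  have hlim : Tendsto (fun v => -(ρ / 2) * ‖v - p‖) (𝓝[≠] p) (𝓝 0) := by
    have hcont : Continuous fun v : V => -(ρ / 2) * ‖v - p‖ := by fun_prop
    simpa using (hcont.tendsto p).mono_left nhdsWithin_le_nhds
  filter_upwards [hlim.eventually_const_le (EReal.coe_lt_coe_iff.1 hδ), self_mem_nhdsWithin]
    with v hv hvp
  have hpos : 0 < ‖v - p‖ := norm_pos_iff.2 (sub_ne_zero.2 hvp)
  rw [EReal.le_div_iff_mul_le (by exact_mod_cast hpos) (EReal.coe_ne_top _),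
    ← EReal.coe_toReal htop hbot]
  by_cases hvtop : F v = ⊤
  · simp [hvtop]
  have hvbot : F v ≠ ⊥ := h.ne_bot hbot v
  have hFv := h.toReal_add_le hbot hvtop
  rw [← EReal.coe_toReal hvtop hvbot]
  norm_cast
  nlinarith

lemma frechetSubdiff_subset_limitingSubdiff (F : V → EReal) (p : V) :
    frechetSubdiff F p ⊆ limitingSubdiff F p := fun w hw =>
  ⟨hw.1, fun _ => p, fun _ => w, tendsto_const_nhds, tendsto_const_nhds, fun _ => hw,
    tendsto_const_nhds⟩

lemma HasKLExponentAt.ne_top (h : HasKLExponentAt F p θ) : F p ≠ ⊤ :=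
  h.1.choose_spec.1.ne

lemma HasKLExponentAt.exists_rpow_le_mul_norm (h : HasKLExponentAt F p θ)
    (hbot : ∀ u, F u ≠ ⊥) :
    ∃ K > 0, ∃ ε > 0, ∃ η > 0, ∀ (u w : V), F u ≠ ⊤ → ‖u - p‖ ≤ ε →
      (F u).toReal - (F p).toReal ∈ Set.Ioo 0 η → w ∈ limitingSubdiff F u →
      ((F u).toReal - (F p).toReal) ^ θ ≤ K * ‖w‖ := by
  obtain ⟨r, hr⟩ : ∃ r : ℝ, F p = r := ⟨_, (EReal.coe_toReal h.ne_top (hbot p)).symm⟩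
  obtain ⟨-, K, ε, η, hK, hε, hη, hKL⟩ := h
  obtain ⟨η', hη', hη'η⟩ := EReal.lt_iff_exists_real_btwn.1 hη
  refine ⟨K, hK, ε, hε, η', EReal.coe_pos.1 hη', fun u w htop hu hdiff hw => ?_⟩
  obtain ⟨t, ht⟩ : ∃ t : ℝ, F u = t := ⟨_, (EReal.coe_toReal htop (hbot u)).symm⟩
  simp only [hr, ht, EReal.toReal_coe] at hKL hdiff ⊢
  have hlt : (t : EReal) < r + η :=
    calc (t : EReal) < r + (η' : EReal) := by
          exact_mod_cast sub_lt_iff_lt_add'.1 hdiff.2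
      _ ≤ r + η := by gcongr
  have hinf := hKL u hu (by rw [ht]; exact_mod_cast sub_pos.1 hdiff.1) (by rwa [ht])
  rw [ht, EReal.toReal_coe] at hinf
  have hdist := hinf.trans (Metric.infEDist_le_edist_of_mem hw)
  rwa [edist_dist, dist_zero_left, ENNReal.ofReal_le_ofReal_iff (norm_nonneg _), one_div,
    ← div_eq_inv_mul, div_le_iff₀' hK] at hdist

end Subgradients

section Trajectories

variable {V : Type*} [NormedAddCommGroup V]

/-- The length `‖x_n - x_{n-1}‖` of the `n`-th step of a sequence, with the convention
`x_{-1} = x_0` of `inertialStep`. -/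
def increment (x : ℕ → V) (n : ℕ) : ℝ :=
  ‖x n - x (n - 1)‖

/-- The Lyapunov function `F (x_n) + C ‖x_n - x_{n-1}‖ ^ 2` of an inertial method: unlike the values
of `F`, it decreases along the iterates. -/
def energy (F : V → EReal) (C : ℝ) (x : ℕ → V) (n : ℕ) : ℝ :=
  (F (x n)).toReal + C * increment x n ^ 2

lemma increment_nonneg (x : ℕ → V) (n : ℕ) : 0 ≤ increment x n :=
  norm_nonneg _

lemma dist_succ_le_increment_add_increment (x : ℕ → V) (n : ℕ) :
    dist (x n) (x (n + 1)) ≤ increment x n + increment x (n + 1) := by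
  rw [dist_comm, dist_eq_norm]
  exact le_add_of_nonneg_left (increment_nonneg x n)

variable [InnerProductSpace ℝ V]

/-- Sufficient decrease of the energy of `x`, together with proximal subgradients of `F` at the
iterates that are controlled by the last two steps. These are the properties of an inertial
proximal gradient method from which its convergence rates follow. -/
structure IsInertialDescentSeq (F : V → EReal) (σ C D W : ℝ) (x : ℕ → V) : Prop where
  energy_pos : 0 < C
  decrease_pos : 0 < D
  subgradient_pos : 0 < W
  decrease : ∀ᶠ n in atTop,
    energy F C x (n + 1) + D * (increment x n + increment x (n + 1)) ^ 2 ≤ energy F C x n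
  subgradient : ∀ᶠ n in atTop, ∃ w, IsProxSubgradient F σ (x (n + 1)) w ∧
    ‖w‖ ≤ W * (increment x n + increment x (n + 1))

variable {F : V → EReal} {σ C D W θ : ℝ} {x : ℕ → V} {p : V}

namespace IsInertialDescentSeq

variable (h : IsInertialDescentSeq F σ C D W x)

include h

lemma eventually_energy_succ_le : ∀ᶠ n in atTop, energy F C x (n + 1) ≤ energy F C x n := by
  filter_upwards [h.decrease] with n hn
  have := mul_nonneg h.decrease_pos.le (sq_nonneg (increment x n + increment x (n + 1)))
  linarith

lemma eventually_ne_top (hp : F p ≠ ⊤) : ∀ᶠ n in atTop, F (x n) ≠ ⊤ := by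
  rw [← map_add_atTop_eq_nat 1, eventually_map]
  filter_upwards [h.subgradient] with n ⟨w, hw, _⟩
  exact ne_top_of_add_coe_le (hw p) hp

lemma eventually_toReal_le_energy (hF : LowerSemicontinuousAt F p) (hbot : F p ≠ ⊥)
    (hp : F p ≠ ⊤) (hx : MapClusterPt p atTop x) :
    ∀ᶠ n in atTop, (F p).toReal ≤ energy F C x n := by
  refine eventually_le_of_frequently_lt h.eventually_energy_succ_le fun c hc => ?_
  refine ((hx.frequently (eventually_lt_toReal hF hbot hp hc)).and_eventually
    (h.eventually_ne_top hp)).mono fun n ⟨hlt, htop⟩ => (hlt htop).trans_le ?_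
  exact le_add_of_nonneg_right (mul_nonneg h.energy_pos.le (sq_nonneg _))

lemma tendsto_increment_add_increment {l : ℝ} (hl : Tendsto (energy F C x) atTop (𝓝 l)) :
    Tendsto (fun n => increment x n + increment x (n + 1)) atTop (𝓝 0) :=
  tendsto_zero_of_sufficient_decrease h.decrease_pos h.decrease hl

lemma tendsto_toReal {l : ℝ} (hl : Tendsto (energy F C x) atTop (𝓝 l)) :
    Tendsto (fun n => (F (x n)).toReal) atTop (𝓝 l) := by
  have hincr : Tendsto (increment x) atTop (𝓝 0) :=
    squeeze_zero (increment_nonneg x)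
      (fun n => le_add_of_nonneg_right (increment_nonneg x (n + 1)))
      (h.tendsto_increment_add_increment hl)
  simpa [energy] using hl.sub ((hincr.pow 2).const_mul C)

lemma eventually_toReal_succ_le (hbot : ∀ u, F u ≠ ⊥) (hp : F p ≠ ⊤) :
    ∀ᶠ n in atTop, (F (x (n + 1))).toReal ≤ (F p).toReal
      + W * (increment x n + increment x (n + 1)) * ‖p - x (n + 1)‖
      + σ / 2 * ‖p - x (n + 1)‖ ^ 2 := by
  filter_upwards [h.subgradient] with n ⟨w, hw, hwW⟩
  have hle := hw.toReal_add_le (hbot _) hp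
  have hinner : -(inner ℝ w (p - x (n + 1)) : ℝ)
      ≤ W * (increment x n + increment x (n + 1)) * ‖p - x (n + 1)‖ :=
    calc -(inner ℝ w (p - x (n + 1)) : ℝ) ≤ ‖w‖ * ‖p - x (n + 1)‖ :=
          (neg_le_abs _).trans (abs_real_inner_le_norm _ _)
      _ ≤ _ := by gcongr
  linarith

lemma tendsto_energy (hF : LowerSemicontinuousAt F p) (hbot : ∀ u, F u ≠ ⊥) (hp : F p ≠ ⊤)
    (hx : MapClusterPt p atTop x) : Tendsto (energy F C x) atTop (𝓝 (F p).toReal) := by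
  have hbelow := h.eventually_toReal_le_energy hF (hbot p) hp hx
  obtain ⟨l, hl⟩ := exists_tendsto_of_eventually_antitone h.eventually_energy_succ_le hbelow
  have hx' : MapClusterPt p atTop fun n => x (n + 1) := by
    rwa [← map_add_atTop_eq_nat 1] at hx
  obtain ⟨U, hU, hxU⟩ := mapClusterPt_iff_ultrafilter.1 hx'
  have hdist : Tendsto (fun n => ‖p - x (n + 1)‖) U (𝓝 0) := by
    simpa using (hxU.const_sub p).norm
  have hupper : Tendsto (fun n => (F p).toReal
      + W * (increment x n + increment x (n + 1)) * ‖p - x (n + 1)‖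
      + σ / 2 * ‖p - x (n + 1)‖ ^ 2) U (𝓝 (F p).toReal) := by
    simpa using ((((h.tendsto_increment_add_increment hl).mono_left hU).const_mul W).mul
      hdist).const_add (F p).toReal |>.add ((hdist.pow 2).const_mul (σ / 2))
  have hle : l ≤ (F p).toReal :=
    le_of_tendsto_of_tendsto
      (((h.tendsto_toReal hl).comp (tendsto_add_atTop_nat 1)).mono_left hU) hupper
      (hU (h.eventually_toReal_succ_le hbot hp))
  rwa [hle.antisymm (ge_of_tendsto hl hbelow)] at hl

lemma exists_energy_rpow_le (hbot : ∀ u, F u ≠ ⊥) (hKL : HasKLExponentAt F p θ)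
    (hθ : θ ∈ Set.Ico (1 / 2 : ℝ) 1) (hlim : Tendsto (energy F C x) atTop (𝓝 (F p).toReal))
    (hnonneg : ∀ᶠ n in atTop, 0 ≤ energy F C x n - (F p).toReal) :
    ∃ E > 0, ∃ ε > 0, ∀ᶠ n in atTop, dist (x (n + 1)) p ≤ ε →
      (energy F C x (n + 1) - (F p).toReal) ^ θ
        ≤ E * (increment x n + increment x (n + 1)) := by
  obtain ⟨K, hK, ε, hε, η, hη, hrpow⟩ := hKL.exists_rpow_le_mul_norm hbot
  have hC := h.energy_pos
  have hW := h.subgradient_pos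
  refine ⟨K * W + C ^ θ, by positivity, ε, hε, ?_⟩
  have hsucc := tendsto_add_atTop_nat 1
  filter_upwards [h.subgradient, hsucc.eventually hnonneg,
    hsucc.eventually (h.eventually_ne_top hKL.ne_top),
    hsucc.eventually ((h.tendsto_toReal hlim).eventually_lt_const (lt_add_of_pos_right _ hη)),
    (h.tendsto_increment_add_increment hlim).eventually_le_const one_pos]
    with n ⟨w, hw, hwW⟩ h0 htop hlt hincr hdist
  have hpos := increment_nonneg x n
  have hpos' := increment_nonneg x (n + 1)
  have henergy : energy F C x (n + 1) - (F p).toReal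
      = (F (x (n + 1))).toReal - (F p).toReal + C * increment x (n + 1) ^ 2 := by
    rw [energy]; ring
  rw [henergy] at h0 ⊢
  have hF (hgap : 0 < (F (x (n + 1))).toReal - (F p).toReal) :
      ((F (x (n + 1))).toReal - (F p).toReal) ^ θ
        ≤ K * (W * (increment x n + increment x (n + 1))) :=
    (hrpow _ w htop (dist_eq_norm (x (n + 1)) p ▸ hdist) ⟨hgap, sub_lt_iff_lt_add'.2 hlt⟩
      (frechetSubdiff_subset_limitingSubdiff _ _ (hw.mem_frechetSubdiff (hbot _) htop))).trans
      (by gcongr)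
  calc _ ≤ K * (W * (increment x n + increment x (n + 1))) + C ^ θ * increment x (n + 1) :=
        rpow_add_mul_sq_le hC.le (Set.Ico_subset_Icc_self hθ) ⟨hpos', by linarith⟩ h0
          (by positivity) hF
    _ ≤ (K * W + C ^ θ) * (increment x n + increment x (n + 1)) := by
      have := mul_nonneg (Real.rpow_nonneg hC.le θ) hpos
      linarith

lemma exists_recursion (hF : LowerSemicontinuousAt F p) (hbot : ∀ u, F u ≠ ⊥)
    (hx : MapClusterPt p atTop x) (hθ : θ ∈ Set.Ico (1 / 2 : ℝ) 1) (hKL : HasKLExponentAt F p θ) :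
    ∃ r : ℕ → ℝ, ∃ κ > 0, ∃ c > 0, Tendsto r atTop (𝓝 0) ∧ ∀ᶠ n in atTop,
      0 ≤ r n ∧ r (n + 1) + κ * r (n + 1) ^ (2 * θ) ≤ r n ∧ (F (x n)).toReal - (F p).toReal ≤ r n ∧
        increment x n ≤ c * r n ^ (1 - θ) ∧ ‖x n - p‖ ≤ c * r n ^ (1 - θ) := by
  have hlim := h.tendsto_energy hF hbot hKL.ne_top hx
  have hnonneg := (h.eventually_toReal_le_energy hF (hbot p) hKL.ne_top hx).mono
    fun n => sub_nonneg.2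
  obtain ⟨E, hE, ε, hε, hrpow⟩ := h.exists_energy_rpow_le hbot hKL hθ hlim hnonneg
  have hlim0 := hlim.sub_const (F p).toReal
  rw [sub_self] at hlim0
  obtain ⟨κ, hκ, c, hc, hrate⟩ := exists_rate_of_descent hx h.decrease_pos hE hε hθ
    (dist_succ_le_increment_add_increment x) hnonneg hlim0
    (h.decrease.mono fun n hn => by linarith) hrpow
  refine ⟨_, κ, hκ, c, hc, hlim0, ?_⟩
  filter_upwards [hnonneg, hrate] with n h0 ⟨hrec, hincr, hdist⟩
  have hle : (F (x n)).toReal ≤ energy F C x n :=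
    le_add_of_nonneg_right (mul_nonneg h.energy_pos.le (sq_nonneg _))
  exact ⟨h0, hrec, by linarith, by linarith [increment_nonneg x (n + 1)],
    dist_eq_norm (x n) p ▸ hdist⟩

end IsInertialDescentSeq

end Trajectories

section Schemes

variable {V : Type*} [NormedAddCommGroup V] [InnerProductSpace ℝ V]

lemma norm_add_smul_sub_sub_le (a : ℝ) (u w p : V) :
    ‖w + a • (w - u) - p‖ ≤ ‖w - p‖ + |a| * ‖w - u‖ := by
  rw [add_sub_right_comm, ← Real.norm_eq_abs, ← norm_smul]
  exact norm_add_le _ _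

variable [CompleteSpace V]

/-- The sequences `x, y, z` are generated by an inertial proximal gradient method for `f + g` with
extrapolation parameters `α, β` and step size `s`, where optimality of `x_{n+1}` is expressed by a
proximal subgradient of `f` with curvature `ρ`. PADISNO is the case `ρ = 1 / s`, c-PADISNO the case
`ρ = 0`; the condition on `a` and `b` specializes to their two step size bounds. -/
structure IsInertialProxGradSeq (f : V → EReal) (g : V → ℝ) (L : ℝ≥0) (α β : ℕ → ℝ) (s ρ : ℝ)
    (x y z : ℕ → V) : Prop where
  step_pos : 0 < s
  parameters : ∃ a b : ℝ, (∀ᶠ n in atTop, |α n| ≤ a) ∧ (∀ᶠ n in atTop, |β n| ≤ b) ∧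
    s * (L * (2 * b + 1) + ρ) + 2 * a < 2
  y_eq : ∀ n, y n = x n + α n • (x n - x (n - 1))
  z_eq : ∀ n, z n = x n + β n • (x n - x (n - 1))
  subgradient : ∀ n,
    IsProxSubgradient f ρ (x (n + 1)) (s⁻¹ • (y n - x (n + 1)) - gradient g (z n))

variable {f : V → EReal} {g : V → ℝ} {L : ℝ≥0} {α β : ℕ → ℝ} {s ρ θ a b : ℝ} {x y z : ℕ → V}
  {p u w : V}

lemma IsProxSubgradient.toReal_compositeObjective_add_le (hs : 0 ≤ s) (hg : Differentiable ℝ g)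
    (hL : LipschitzWith L (gradient g)) (hbot : f p ≠ ⊥)
    (htop : compositeObjective f g w ≠ ⊤)
    (h : IsProxSubgradient f ρ p
      (s⁻¹ • (w + a • (w - u) - p) - gradient g (w + b • (w - u)))) :
    (compositeObjective f g p).toReal + (s⁻¹ - (ρ + L) / 2) * ‖p - w‖ ^ 2
      ≤ (compositeObjective f g w).toReal + (s⁻¹ * |a| + L * |b|) * (‖w - u‖ * ‖p - w‖) := by
  set ζ := w + b • (w - u)
  have hgrad : inner ℝ (gradient g ζ - gradient g w) (w - p) ≤ L * |b| * (‖w - u‖ * ‖p - w‖) :=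
    calc inner ℝ (gradient g ζ - gradient g w) (w - p)
        ≤ ‖gradient g ζ - gradient g w‖ * ‖w - p‖ := real_inner_le_norm _ _
      _ ≤ L * ‖ζ - w‖ * ‖w - p‖ := by gcongr; exact hL.norm_sub_le _ _
      _ = L * |b| * (‖w - u‖ * ‖p - w‖) := by
        rw [add_sub_cancel_left, norm_smul, Real.norm_eq_abs, norm_sub_rev w p]; ring
  have hinertia : -(a * inner ℝ (w - u) (w - p)) ≤ |a| * (‖w - u‖ * ‖p - w‖) :=
    calc -(a * inner ℝ (w - u) (w - p)) ≤ |a| * |inner ℝ (w - u) (w - p)| := by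
          rw [← abs_mul]; exact neg_le_abs _
      _ ≤ |a| * (‖w - u‖ * ‖p - w‖) := by
          rw [norm_sub_rev p w]; gcongr; exact abs_real_inner_le_norm _ _
  have hslope : inner ℝ (s⁻¹ • (w + a • (w - u) - p) - gradient g ζ) (w - p)
      = s⁻¹ * (‖p - w‖ ^ 2 + a * inner ℝ (w - u) (w - p)) - inner ℝ (gradient g ζ) (w - p) := by
    rw [add_sub_right_comm, inner_sub_left, inner_smul_left, inner_add_left, inner_smul_left,
      real_inner_self_eq_norm_sq, norm_sub_rev w p]
    simp only [conj_trivial]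
  have hsmooth := (abs_le.1 (abs_sub_sub_inner_gradient_le hg hL w p)).2
  rw [← neg_sub w p, inner_neg_right, neg_sub] at hsmooth
  have hinertia' := mul_le_mul_of_nonneg_left hinertia (inv_nonneg.2 hs)
  rw [inner_sub_left] at hgrad
  have hle := toReal_add_le_toReal_of_add_coe_le (compositeObjective_ne_bot g hbot) htop
    (add_coe_add_coe_le_add_coe (h w) (t := g p) (t' := g w)
      (r' := (s⁻¹ - (ρ + L) / 2) * ‖p - w‖ ^ 2
        - (s⁻¹ * |a| + L * |b|) * (‖w - u‖ * ‖p - w‖)) (by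
      rw [hslope, norm_sub_rev w p]
      linarith))
  linarith

lemma norm_residual_le (hs : 0 ≤ s) (hL : LipschitzWith L (gradient g)) :
    ‖s⁻¹ • (w + a • (w - u) - p) - gradient g (w + b • (w - u)) + gradient g p‖
      ≤ s⁻¹ * (‖p - w‖ + |a| * ‖w - u‖) + L * (‖p - w‖ + |b| * ‖w - u‖) := by
  rw [sub_add, norm_sub_rev p w]
  refine (norm_sub_le _ _).trans (add_le_add ?_ ?_)
  · rw [norm_smul, Real.norm_of_nonneg (inv_nonneg.2 hs)]
    gcongr
    exact norm_add_smul_sub_sub_le a u w p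
  · refine (hL.norm_sub_le _ _).trans ?_
    gcongr
    exact norm_add_smul_sub_sub_le b u w p

namespace IsInertialProxGradSeq

variable (h : IsInertialProxGradSeq f g L α β s ρ x y z)

include h

lemma exists_nonneg_parameters : ∃ a ≥ 0, ∃ b ≥ 0,
    s⁻¹ * a + L * b < s⁻¹ - (ρ + L) / 2 ∧ ∀ᶠ n in atTop, |α n| ≤ a ∧ |β n| ≤ b := by
  obtain ⟨a, b, ha, hb, hab⟩ := h.parameters
  obtain ⟨n, han, hbn⟩ := (ha.and hb).exists
  have hs := h.step_pos
  refine ⟨a, (abs_nonneg _).trans han, b, (abs_nonneg _).trans hbn, ?_, ha.and hb⟩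
  refine lt_of_mul_lt_mul_left (a := 2 * s) ?_ (by positivity)
  calc 2 * s * (s⁻¹ * a + L * b) = 2 * a + s * (2 * L * b) := by field_simp
    _ < 2 - s * (ρ + L) := by linarith
    _ = 2 * s * (s⁻¹ - (ρ + L) / 2) := by field_simp

lemma compositeObjective_ne_top (hp : compositeObjective f g p ≠ ⊤) {n : ℕ} (hn : n ≠ 0)
    (hg : Differentiable ℝ g) (hL : LipschitzWith L (gradient g)) :
    compositeObjective f g (x n) ≠ ⊤ := by
  obtain ⟨k, rfl⟩ := Nat.exists_eq_add_one_of_ne_zero hn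
  exact ne_top_of_add_coe_le ((h.subgradient k).add_gradient hg hL p) hp

lemma exists_subgradient_bound (hg : Differentiable ℝ g) (hL : LipschitzWith L (gradient g)) :
    ∃ W > 0, ∀ᶠ n in atTop, ∃ w,
      IsProxSubgradient (compositeObjective f g) (ρ + L) (x (n + 1)) w ∧
        ‖w‖ ≤ W * (increment x n + increment x (n + 1)) := by
  obtain ⟨a, ha, b, hb, -, hab⟩ := h.exists_nonneg_parameters
  have hs := h.step_pos
  refine ⟨s⁻¹ * (1 + a) + L * (1 + b), by positivity, hab.mono fun n ⟨han, hbn⟩ =>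
    ⟨_, (h.subgradient n).add_gradient hg hL, ?_⟩⟩
  rw [h.y_eq, h.z_eq]
  have hstep {c γ : ℝ} (hc : 0 ≤ c) (hγ : |γ| ≤ c) :
      increment x (n + 1) + |γ| * increment x n
        ≤ (1 + c) * (increment x n + increment x (n + 1)) := by
    have hle := mul_le_mul_of_nonneg_right hγ (increment_nonneg x n)
    have hnonneg := mul_nonneg hc (increment_nonneg x (n + 1))
    linarith [increment_nonneg x n]
  calc _ ≤ s⁻¹ * (increment x (n + 1) + |α n| * increment x n)
        + L * (increment x (n + 1) + |β n| * increment x n) := norm_residual_le hs.le hL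
    _ ≤ s⁻¹ * ((1 + a) * (increment x n + increment x (n + 1)))
        + L * ((1 + b) * (increment x n + increment x (n + 1))) :=
      add_le_add (mul_le_mul_of_nonneg_left (hstep ha han) (inv_nonneg.2 hs.le))
        (mul_le_mul_of_nonneg_left (hstep hb hbn) L.2)
    _ = _ := by ring

lemma exists_energy_decrease (hg : Differentiable ℝ g) (hL : LipschitzWith L (gradient g))
    (hbot : ∀ u, f u ≠ ⊥) (hp : compositeObjective f g p ≠ ⊤) :
    ∃ C > 0, ∃ D > 0, ∀ᶠ n in atTop, energy (compositeObjective f g) C x (n + 1)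
      + D * (increment x n + increment x (n + 1)) ^ 2 ≤ energy (compositeObjective f g) C x n := by
  obtain ⟨a, ha, b, hb, hlt, hab⟩ := h.exists_nonneg_parameters
  have hs := h.step_pos
  have hnonneg : 0 ≤ s⁻¹ * a + L * b := by positivity
  set c := s⁻¹ * a + L * b with hc
  set μ := s⁻¹ - (ρ + L) / 2
  refine ⟨μ / 2, by linarith, (μ - c) / 4, by linarith, ?_⟩
  filter_upwards [hab, eventually_ne_atTop 0] with n ⟨han, hbn⟩ hn
  have hξ := h.subgradient n
  rw [h.y_eq, h.z_eq] at hξ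
  have hcoeff : s⁻¹ * |α n| + L * |β n| ≤ c := by
    rw [hc]
    gcongr
  have hstep : (compositeObjective f g (x (n + 1))).toReal + μ * increment x (n + 1) ^ 2
      ≤ (compositeObjective f g (x n)).toReal + c * (increment x n * increment x (n + 1)) :=
    (hξ.toReal_compositeObjective_add_le hs.le hg hL (hbot _)
      (h.compositeObjective_ne_top hp hn hg hL)).trans
      (add_le_add le_rfl (mul_le_mul_of_nonneg_right hcoeff
        (mul_nonneg (increment_nonneg x n) (increment_nonneg x (n + 1)))))
  have hsquare : 0 ≤ (μ + c) / 4 * (increment x n - increment x (n + 1)) ^ 2 :=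
    mul_nonneg (by linarith) (sq_nonneg _)
  rw [energy, energy]
  linarith

lemma exists_isInertialDescentSeq (hg : Differentiable ℝ g) (hL : LipschitzWith L (gradient g))
    (hbot : ∀ u, f u ≠ ⊥) (hp : compositeObjective f g p ≠ ⊤) :
    ∃ C D W, IsInertialDescentSeq (compositeObjective f g) (ρ + L) C D W x := by
  obtain ⟨C, hC, D, hD, hdecrease⟩ := h.exists_energy_decrease hg hL hbot hp
  obtain ⟨W, hW, hsub⟩ := h.exists_subgradient_bound hg hL
  exact ⟨C, D, W, hC, hD, hW, hdecrease, hsub⟩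

lemma exists_extrapolation_bound : ∃ c > 0, ∀ᶠ n in atTop, ∀ p,
    ‖y n - p‖ ≤ c * (‖x n - p‖ + increment x n) ∧ ‖z n - p‖ ≤ c * (‖x n - p‖ + increment x n) := by
  obtain ⟨a, ha, b, hb, -, hab⟩ := h.exists_nonneg_parameters
  refine ⟨1 + a + b, by positivity, hab.mono fun n ⟨han, hbn⟩ p => ?_⟩
  have hle {γ : ℝ} (hγ : |γ| ≤ a + b) :
      ‖x n + γ • (x n - x (n - 1)) - p‖ ≤ (1 + a + b) * (‖x n - p‖ + increment x n) :=
    calc _ ≤ ‖x n - p‖ + |γ| * increment x n := norm_add_smul_sub_sub_le γ _ _ p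
      _ ≤ ‖x n - p‖ + (a + b) * increment x n :=
        add_le_add le_rfl (mul_le_mul_of_nonneg_right hγ (increment_nonneg x n))
      _ ≤ _ := by
        have := mul_nonneg (add_nonneg ha hb) (norm_nonneg (x n - p))
        linarith [increment_nonneg x n]
  rw [h.y_eq, h.z_eq]
  exact ⟨hle (by linarith [han]), hle (by linarith [hbn])⟩

lemma exists_recursion (hf : LowerSemicontinuousAt f p) (hbot : ∀ u, f u ≠ ⊥)
    (hg : Differentiable ℝ g) (hL : LipschitzWith L (gradient g)) (hx : MapClusterPt p atTop x)
    (hθ : θ ∈ Set.Ico (1 / 2 : ℝ) 1) (hKL : HasKLExponentAt (compositeObjective f g) p θ) :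
    ∃ r : ℕ → ℝ, ∃ κ > 0, ∃ c > 0, Tendsto r atTop (𝓝 0) ∧ (∀ᶠ n in atTop, 0 ≤ r n) ∧
      (∀ᶠ n in atTop, r (n + 1) + κ * r (n + 1) ^ (2 * θ) ≤ r n) ∧ ∀ᶠ n in atTop,
        compositeObjective f g (x n) - compositeObjective f g p ≤ (r n : EReal) ∧
        ‖x n - p‖ ≤ c * r n ^ (1 - θ) ∧ ‖y n - p‖ ≤ c * r n ^ (1 - θ) ∧
        ‖z n - p‖ ≤ c * r n ^ (1 - θ) := by
  have hbot' u : compositeObjective f g u ≠ ⊥ := compositeObjective_ne_bot g (hbot u)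
  obtain ⟨C, D, W, hdescent⟩ := h.exists_isInertialDescentSeq hg hL hbot hKL.ne_top
  obtain ⟨r, κ, hκ, c, hc, hr, hrate⟩ := hdescent.exists_recursion
    (lowerSemicontinuousAt_compositeObjective hf hg.continuous.continuousAt) hbot' hx hθ hKL
  obtain ⟨c', hc', hyz⟩ := h.exists_extrapolation_bound
  refine ⟨r, κ, hκ, c + 2 * c' * c, by positivity, hr, hrate.mono fun n hn => hn.1,
    hrate.mono fun n hn => hn.2.1, ?_⟩
  filter_upwards [hrate, hyz, hdescent.eventually_ne_top hKL.ne_top]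
    with n ⟨h0, _, hF, hincr, hxp⟩ hyzn htop
  have hc'r : 0 ≤ c' * (c * r n ^ (1 - θ)) := by positivity
  have hextra : c' * (‖x n - p‖ + increment x n) ≤ (c + 2 * c' * c) * r n ^ (1 - θ) :=
    calc c' * (‖x n - p‖ + increment x n)
        ≤ c' * (c * r n ^ (1 - θ) + c * r n ^ (1 - θ)) := by gcongr
      _ ≤ (c + 2 * c' * c) * r n ^ (1 - θ) := by
        have : 0 ≤ c * r n ^ (1 - θ) := by positivity
        linarith
  refine ⟨?_, by linarith, (hyzn p).1.trans hextra, (hyzn p).2.trans hextra⟩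
  rw [← EReal.coe_toReal htop (hbot' _), ← EReal.coe_toReal hKL.ne_top (hbot' p)]
  exact_mod_cast hF

end IsInertialProxGradSeq

end Schemes

section Instances

variable {m : ℕ} {f : EuclideanSpace ℝ (Fin m) → EReal} {g : EuclideanSpace ℝ (Fin m) → ℝ}
  {L : ℝ≥0} {α β : ℕ → ℝ} {s ρ : ℝ} {x y z : ℕ → EuclideanSpace ℝ (Fin m)}
  {p u w : EuclideanSpace ℝ (Fin m)}

lemma IsSeqClusterPt.mapClusterPt (h : IsSeqClusterPt x p) : MapClusterPt p atTop x := by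
  obtain ⟨φ, hφ, hlim⟩ := h
  exact hlim.mapClusterPt.of_comp hφ.tendsto_atTop

lemma IsProx.isProxSubgradient (h : IsProx s f u p) (hs : s ≠ 0) :
    IsProxSubgradient f s⁻¹ p (s⁻¹ • (u - p)) :=
  isProxSubgradient_of_forall_add_le (q := fun v => 1 / (2 * s) * ‖v - u‖ ^ 2) h fun v => by
    rw [norm_sub_sq_eq_add_inner_add u v p, real_inner_smul_left]
    field_simp

lemma IsConvex.isProxSubgradient_zero (hf : IsConvex f) (h : IsProxSubgradient f ρ p w) :
    IsProxSubgradient f 0 p w := fun v => by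
  by_cases hbot : f p = ⊥
  · simp [hbot]
  by_cases htop : f v = ⊤
  · simp [htop]
  have hvbot : f v ≠ ⊥ := h.ne_bot hbot v
  have hstep : ∀ t ∈ Set.Ioo (0 : ℝ) 1, (f p).toReal
      + (inner ℝ w (v - p) - t * (ρ / 2 * ‖v - p‖ ^ 2)) ≤ (f v).toReal := by
    rintro t ⟨ht0, ht1⟩
    have hcombo := (h ((1 - t) • p + t • v)).trans
      (hf p v (1 - t) t (sub_pos.2 ht1) ht0 (sub_add_cancel 1 t))
    rw [show (1 - t) • p + t • v - p = t • (v - p) by module, norm_smul, inner_smul_right,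
      Real.norm_of_nonneg ht0.le, ← EReal.coe_toReal (ne_top_of_add_coe_le (h v) htop) hbot,
      ← EReal.coe_toReal htop hvbot] at hcombo
    norm_cast at hcombo
    refine le_of_mul_le_mul_left ?_ ht0
    linarith
  have hlim : Tendsto (fun t => (f p).toReal + (inner ℝ w (v - p) - t * (ρ / 2 * ‖v - p‖ ^ 2)))
      (𝓝[>] 0) (𝓝 ((f p).toReal + (inner ℝ w (v - p) - 0 * (ρ / 2 * ‖v - p‖ ^ 2)))) :=
    Continuous.continuousWithinAt (by fun_prop)
  have hle := le_of_tendsto hlim (eventually_of_mem (Ioo_mem_nhdsGT one_pos) hstep)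
  rw [← EReal.coe_toReal (ne_top_of_add_coe_le (h v) htop) hbot, ← EReal.coe_toReal htop hvbot]
  norm_cast
  simpa using hle

lemma exists_eventually_abs_le_of_tendsto {a b : ℝ} (hα : Tendsto α atTop (𝓝 a))
    (hβ : Tendsto β atTop (𝓝 b))
    (hab : s * (L * (2 * |b| + 1) + ρ) + 2 * |a| < 2) :
    ∃ a' b' : ℝ, (∀ᶠ n in atTop, |α n| ≤ a') ∧ (∀ᶠ n in atTop, |β n| ≤ b') ∧
      s * (L * (2 * b' + 1) + ρ) + 2 * a' < 2 := by
  have hcont : Continuous fun δ : ℝ => s * (L * (2 * (|b| + δ) + 1) + ρ) + 2 * (|a| + δ) := by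
    fun_prop
  obtain ⟨δ, hδ, hδpos⟩ := (((hcont.tendsto 0).mono_left nhdsWithin_le_nhds).eventually_lt_const
    (by simpa using hab) |>.and (self_mem_nhdsWithin (s := Set.Ioi (0 : ℝ)))).exists
  exact ⟨|a| + δ, |b| + δ, hα.abs.eventually_le_const (lt_add_of_pos_right _ hδpos),
    hβ.abs.eventually_le_const (lt_add_of_pos_right _ hδpos), hδ⟩

lemma IsPADISNO.isInertialProxGradSeq (h : IsPADISNO f g L α β s x y z) :
    IsInertialProxGradSeq f g L α β s s⁻¹ x y z := by
  obtain ⟨a, b, hα, hβ, -, hs, hab⟩ := h.parameters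
  refine ⟨hs, exists_eventually_abs_le_of_tendsto hα hβ ?_, h.y_eq, h.z_eq, fun n =>
    isProxSubgradient_of_forall_add_le
      (q := fun v => inner ℝ (gradient g (z n)) (v - y n) + 1 / (2 * s) * ‖v - y n‖ ^ 2)
      (h.x_argmin n) fun v => ?_⟩
  · rw [mul_add, mul_inv_cancel₀ hs.ne']
    linarith
  · rw [norm_sub_sq_eq_add_inner_add (y n) v (x (n + 1)), inner_sub_left (s⁻¹ • _),
      real_inner_smul_left,
      ← sub_add_sub_cancel v (x (n + 1)) (y n), inner_add_right]
    field_simp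
    ring

lemma IsConvexPADISNO.isInertialProxGradSeq (h : IsConvexPADISNO f g L α β s x y z) :
    IsInertialProxGradSeq f g L α β s 0 x y z := by
  obtain ⟨a, b, hα, hβ, -, hs, hab⟩ := h.parameters
  refine ⟨hs, exists_eventually_abs_le_of_tendsto hα hβ (by linarith), h.y_eq, h.z_eq,
    fun n => ?_⟩
  have hprox := h.convex.isProxSubgradient_zero ((h.x_prox n).isProxSubgradient hs.ne')
  rwa [sub_right_comm, smul_sub, inv_smul_smul₀ hs.ne'] at hprox

end Instances

end Padisno

theorem mainTheorem8_general {V : Type*} [NormedAddCommGroup V] [InnerProductSpace ℝ V]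
    [CompleteSpace V] {f : V → EReal} {g : V → ℝ} {L : ℝ≥0} {α β : ℕ → ℝ} {s ρ : ℝ}
    {x y z : ℕ → V} {xstar : V} {θ : ℝ} (hbot : ∀ u, f u ≠ ⊥)
    (hf : LowerSemicontinuousAt f xstar) (hg : Differentiable ℝ g)
    (hL : LipschitzWith L (gradient g))
    (hxyz : Padisno.IsInertialProxGradSeq f g L α β s ρ x y z) (hxstar : MapClusterPt xstar atTop x)
    (hθ : θ ∈ Set.Ico (1 / 2 : ℝ) 1)
    (hKL : Padisno.HasKLExponentAt (Padisno.compositeObjective f g) xstar θ) :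
    (θ = 1 / 2 →
      ∃ a₁ : ℝ, 0 < a₁ ∧ ∃ Q ∈ Set.Ico (0 : ℝ) 1, ∃ N : ℕ, ∀ n ≥ N,
        Padisno.compositeObjective f g (x n) - Padisno.compositeObjective f g xstar
          ≤ ((a₁ * Q ^ n : ℝ) : EReal) ∧
        ‖x n - xstar‖ ≤ a₁ * Q ^ ((n : ℝ) / 2) ∧
        ‖y n - xstar‖ ≤ a₁ * Q ^ ((n : ℝ) / 2) ∧
        ‖z n - xstar‖ ≤ a₁ * Q ^ ((n : ℝ) / 2)) ∧
    (θ ∈ Set.Ioo (1 / 2 : ℝ) 1 →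
      ∃ a₂ : ℝ, 0 < a₂ ∧ ∃ N : ℕ, ∀ n ≥ N,
        Padisno.compositeObjective f g (x n) - Padisno.compositeObjective f g xstar
          ≤ ((a₂ * (n : ℝ) ^ (-(1 / (2 * θ - 1))) : ℝ) : EReal) ∧
        ‖x n - xstar‖ ≤ a₂ * (n : ℝ) ^ ((θ - 1) / (2 * θ - 1)) ∧
        ‖y n - xstar‖ ≤ a₂ * (n : ℝ) ^ ((θ - 1) / (2 * θ - 1)) ∧
        ‖z n - xstar‖ ≤ a₂ * (n : ℝ) ^ ((θ - 1) / (2 * θ - 1))) := by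
  obtain ⟨r, κ, hκ, c, hc, hr, h0, hrec, hbound⟩ :=
    hxyz.exists_recursion hf hbot hg hL hxstar hθ hKL
  constructor
  · rintro rfl
    obtain ⟨a, ha, Q, hQ, hrate⟩ := Padisno.exists_linear_rate hκ hc.le h0
      (by simpa using hrec)
    obtain ⟨N, hN⟩ := eventually_atTop.1 (hrate.and hbound)
    refine ⟨a, ha, Q, hQ, N, fun n hn => ?_⟩
    obtain ⟨⟨hr', hrate'⟩, hF, hx, hy, hz⟩ := hN n hn
    rw [show (1 : ℝ) - 1 / 2 = 1 / 2 by norm_num] at hx hy hz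
    exact ⟨hF.trans (EReal.coe_le_coe_iff.2 hr'), hx.trans hrate', hy.trans hrate',
      hz.trans hrate'⟩
  · intro hθ'
    obtain ⟨a, ha, hrate⟩ := Padisno.exists_sublinear_rate hκ hc.le hθ' h0 hr hrec
    obtain ⟨N, hN⟩ := eventually_atTop.1 (hrate.and hbound)
    refine ⟨a, ha, N, fun n hn => ?_⟩
    obtain ⟨⟨hr', hrate'⟩, hF, hx, hy, hz⟩ := hN n hn
    exact ⟨hF.trans (EReal.coe_le_coe_iff.2 hr'), hx.trans hrate', hy.trans hrate',
      hz.trans hrate'⟩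

theorem mainTheorem8 {m : ℕ}
    (f : EuclideanSpace ℝ (Fin m) → EReal) (g : EuclideanSpace ℝ (Fin m) → ℝ) (L : ℝ≥0)
    (hfg : Padisno.IsProblem f g L)
    (α β : ℕ → ℝ) (s : ℝ) (x y z : ℕ → EuclideanSpace ℝ (Fin m))
    (hxyz : Padisno.IsPADISNO f g L α β s x y z ∨ Padisno.IsConvexPADISNO f g L α β s x y z)
    (hbdd : Padisno.BoundedFromBelow (Padisno.objective f g))
    (xstar : EuclideanSpace ℝ (Fin m)) (hxstar : Padisno.IsSeqClusterPt x xstar)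
    (θ : ℝ) (hθ : θ ∈ Set.Ico (1 / 2 : ℝ) 1)
    (hKL : Padisno.HasKLExponentAt (Padisno.objective f g) xstar θ) :
    (θ = 1 / 2 →
      ∃ a₁ : ℝ, 0 < a₁ ∧ ∃ Q ∈ Set.Ico (0 : ℝ) 1, ∃ N : ℕ, ∀ n ≥ N,
        Padisno.objective f g (x n) - Padisno.objective f g xstar ≤ ((a₁ * Q ^ n : ℝ) : EReal) ∧
        ‖x n - xstar‖ ≤ a₁ * Q ^ ((n : ℝ) / 2) ∧
        ‖y n - xstar‖ ≤ a₁ * Q ^ ((n : ℝ) / 2) ∧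
        ‖z n - xstar‖ ≤ a₁ * Q ^ ((n : ℝ) / 2)) ∧
    (θ ∈ Set.Ioo (1 / 2 : ℝ) 1 →
      ∃ a₂ : ℝ, 0 < a₂ ∧ ∃ N : ℕ, ∀ n ≥ N,
        Padisno.objective f g (x n) - Padisno.objective f g xstar
          ≤ ((a₂ * (n : ℝ) ^ (-(1 / (2 * θ - 1))) : ℝ) : EReal) ∧
        ‖x n - xstar‖ ≤ a₂ * (n : ℝ) ^ ((θ - 1) / (2 * θ - 1)) ∧
        ‖y n - xstar‖ ≤ a₂ * (n : ℝ) ^ ((θ - 1) / (2 * θ - 1)) ∧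
        ‖z n - xstar‖ ≤ a₂ * (n : ℝ) ^ ((θ - 1) / (2 * θ - 1))) := by
  have ⟨ρ, h⟩ : ∃ ρ, Padisno.IsInertialProxGradSeq f g L α β s ρ x y z :=
    hxyz.elim (fun h => ⟨s⁻¹, h.isInertialProxGradSeq⟩) fun h => ⟨0, h.isInertialProxGradSeq⟩
  exact mainTheorem8_general hfg.ne_bot (hfg.lsc xstar) hfg.differentiable hfg.lipschitz_gradient h
    hxstar.mapClusterPt hθ hKL
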